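/- Let $F_2$ be the free group on $x,y$, let $\mathbb C[F_2]$ be the ring of noncommutative Laurent polynomials in $x,y$ (so the elements of $F_2$ are the Laurent monomials), and let $\mathbb F=\mathbb C(x,y)$ be the skew field of rational functions in the noncommuting variables $x,y$, i.e. the universal skew field of fractions of $\mathbb C[F_2]$ (equivalently, of the free algebra $\mathbb C\langle x,y\rangle$), obtained by universally inverting all full square matrices over $\mathbb C[F_2]$. Put $C=xyx^{-1}y^{-1}$, and let $*$ be the $\mathbb C$-linear anti-automorphism of $\mathbb F$ with $x^*=yC$ and $y^*=C^{-1}x$. The noncommutative $(2,2)$-system $$R_{n+1}\,C\,R_{n-1}=R_n^2+1\quad(n\in\mathbb Z),\qquad CR_0=x,\quad R_1=y,$$ has exactly one solution $(R_n)_{n\in\mathbb Z}$ in $\mathbb F$, and it satisfies $R_{-n}=(R_{n+1})^*$ for all $n\in\mathbb Z$. Consider paths on the segment $[0,3]$ with vertices $0,1,2,3$ and steps $i\to i\pm1$, starting and ending at $0$. A step $i\to i+1$ has weight $1$, and a step $i\to i-1$ has weight $y_i$, where $$y_1=y^2x^{-1}y^{-1},\qquad y_2=x^{-1}y^{-1},\qquad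 y_3=xy^{-1};$$ the weight $w(p)\in F_2$ of a path $p$ is the product of its step weights from left to right in the order in which the steps are taken. Note that $R_0=yxy^{-1}$ is a Laurent monomial. Then for every $n\in\mathbb Z$ the solution $R_n$ is (the image in $\mathbb F$ of) a Laurent polynomial in $x,y$ all of whose coefficients lie in $\{0,1\}$. Moreover: - if $n\ge 0$, then $p\mapsto w(p)R_0$ is a bijection from the set of such paths with $2n$ steps onto the set of Laurent monomials occurring in this expression for $R_n$; - if $n<0$, then $p\mapsto (w(p)R_0)^*$ is a bijection from the set of such paths with $2(1-n)$ steps onto the set of Laurent monomials occurring in this expression for $R_n$. -/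

import Mathlib

/-! ### The universal skew field of fractions

For a ring `R` that is a semifir (for instance a free associative algebra or the group algebra of a
free group over a field), adjoining to `R` universally the inverses of all full square matrices
produces the universal skew field of fractions of `R` (Cohn).  The group algebra `ℂ[F₂]` of the free
group on `x, y` and the free algebra `ℂ⟨x, y⟩` have the same universal skew field of fractions: the
skew field `ℂ(x, y)` of rational functions in the noncommuting variables `x, y`. -/

/-- A square matrix of size `n` is full if it does not factor through a smaller size `m < n`. -/
def IsFullMatrix {R : Type} [Ring R] {n : ℕ} (A : Matrix (Fin n) (Fin n) R) : Prop :=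
  ∀ (m : ℕ) (P : Matrix (Fin n) (Fin m) R) (Q : Matrix (Fin m) (Fin n) R), A = P * Q → n ≤ m

/-- Names for the entries of the inverses to be adjoined: a full matrix with a pair of indices. -/
abbrev InverseEntry (R : Type) [Ring R] : Type :=
  Σ n : ℕ, {A : Matrix (Fin n) (Fin n) R // IsFullMatrix A} × Fin n × Fin n

namespace FullLocalization

variable (k R : Type) [CommRing k] [Ring R] [Algebra k R]

/-- The symbol of an element of `R`. -/
def base (a : R) : FreeAlgebra k (R ⊕ InverseEntry R) := FreeAlgebra.ι k (Sum.inl a)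

/-- The symbol of the `(i, j)` entry of the inverse of the full matrix `A`. -/
def inverse {n : ℕ} (A : {A : Matrix (Fin n) (Fin n) R // IsFullMatrix A}) (i j : Fin n) :
    FreeAlgebra k (R ⊕ InverseEntry R) := FreeAlgebra.ι k (Sum.inr ⟨n, A, i, j⟩)

/-- Defining relations: `R` maps in as a `k`-algebra, and every full matrix gets a two-sided
inverse. -/
inductive Rel : FreeAlgebra k (R ⊕ InverseEntry R) → FreeAlgebra k (R ⊕ InverseEntry R) → Prop
  | add (a b : R) : Rel (base k R (a + b)) (base k R a + base k R b)
  | mul (a b : R) : Rel (base k R (a * b)) (base k R a * base k R b)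
  | scalar (c : k) : Rel (base k R (algebraMap k R c)) (algebraMap k _ c)
  | mul_inv {n : ℕ} (A : {A : Matrix (Fin n) (Fin n) R // IsFullMatrix A}) (i j : Fin n) :
      Rel (∑ l, base k R (A.1 i l) * inverse k R A l j) (if i = j then 1 else 0)
  | inv_mul {n : ℕ} (A : {A : Matrix (Fin n) (Fin n) R // IsFullMatrix A}) (i j : Fin n) :
      Rel (∑ l, inverse k R A i l * base k R (A.1 l j)) (if i = j then 1 else 0)

end FullLocalization

/-- The universal localization of the `k`-algebra `R` at all full matrices. -/
abbrev FullLocalization (k R : Type) [CommRing k] [Ring R] [Algebra k R] : Type :=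
  RingQuot (FullLocalization.Rel k R)

namespace FullLocalization

section General

variable (k R : Type) [CommRing k] [Ring R] [Algebra k R]

/-- The canonical map from `R` to its localization. -/
noncomputable def incl : R →ₐ[k] FullLocalization k R :=
  AlgHom.ofLinearMap
    { toFun := fun a => RingQuot.mkAlgHom k (Rel k R) (base k R a)
      map_add' := fun a b => by
        rw [RingQuot.mkAlgHom_rel k (Rel.add a b), map_add]
      map_smul' := fun c a => by
        rw [Algebra.smul_def, RingQuot.mkAlgHom_rel k (Rel.mul _ a), map_mul,
          RingQuot.mkAlgHom_rel k (Rel.scalar c), AlgHom.commutes, RingHom.id_apply,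
          Algebra.smul_def] }
    (by
      have h := RingQuot.mkAlgHom_rel k (Rel.scalar (k := k) (R := R) 1)
      simpa only [map_one, LinearMap.coe_mk, AddHom.coe_mk] using h)
    (fun a b => by
      simp only [LinearMap.coe_mk, AddHom.coe_mk]
      rw [RingQuot.mkAlgHom_rel k (Rel.mul a b), map_mul])

/-- The inverse, over the localization, of a full matrix. -/
noncomputable def inv {n : ℕ} (A : {A : Matrix (Fin n) (Fin n) R // IsFullMatrix A})
    (i j : Fin n) : FullLocalization k R :=
  RingQuot.mkAlgHom k (Rel k R) (inverse k R A i j)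

theorem incl_mul_inv {n : ℕ} (A : {A : Matrix (Fin n) (Fin n) R // IsFullMatrix A})
    (i j : Fin n) : ∑ l, incl k R (A.1 i l) * inv k R A l j = if i = j then 1 else 0 := by
  have h := RingQuot.mkAlgHom_rel k (Rel.mul_inv (k := k) A i j)
  rw [map_sum] at h
  simp only [map_mul] at h
  refine h.trans ?_
  split_ifs <;> simp

theorem inv_mul_incl {n : ℕ} (A : {A : Matrix (Fin n) (Fin n) R // IsFullMatrix A})
    (i j : Fin n) : ∑ l, inv k R A i l * incl k R (A.1 l j) = if i = j then 1 else 0 := by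
  have h := RingQuot.mkAlgHom_rel k (Rel.inv_mul (k := k) A i j)
  rw [map_sum] at h
  simp only [map_mul] at h
  refine h.trans ?_
  split_ifs <;> simp

end General

section Anti

variable {k R : Type} [CommRing k] [Ring R] [Algebra k R]

/-- The image of a full matrix under an involutive anti-automorphism, applied to the entries of the
transpose, is full. -/
def antiMatrix (σ : R →ₐ[k] Rᵐᵒᵖ) (hσ : ∀ a, (σ (σ a).unop).unop = a) {n : ℕ}
    (A : {A : Matrix (Fin n) (Fin n) R // IsFullMatrix A}) :
    {A : Matrix (Fin n) (Fin n) R // IsFullMatrix A} :=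
  ⟨fun i j => (σ (A.1 j i)).unop, by
    intro m P Q h
    refine A.2 m (fun i j => (σ (Q j i)).unop) (fun i j => (σ (P j i)).unop) ?_
    ext i j
    have h1 := congrFun (congrFun h j) i
    simp only [Matrix.mul_apply] at h1 ⊢
    rw [← hσ (A.1 i j), h1, map_sum, Finset.unop_sum]
    simp only [map_mul, MulOpposite.unop_mul]
    rfl⟩

/-- The extension to the localization of an involutive anti-automorphism of `R`. -/
noncomputable def antiHom (σ : R →ₐ[k] Rᵐᵒᵖ) (hσ : ∀ a, (σ (σ a).unop).unop = a) :
    FullLocalization k R →ₐ[k] (FullLocalization k R)ᵐᵒᵖ :=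
  RingQuot.liftAlgHom k
    ⟨FreeAlgebra.lift k (Sum.elim
      (fun a => MulOpposite.op (incl k R (σ a).unop))
      (fun e => MulOpposite.op (inv k R (antiMatrix σ hσ e.2.1) e.2.2.2 e.2.2.1))), by
      intro u v h
      induction h with
      | add a b => simp [base]
      | mul a b => simp [base]
      | scalar c => simp [base, AlgHom.commutes, MulOpposite.algebraMap_apply]
      | mul_inv A i j =>
        apply MulOpposite.unop_injective
        simp only [base, inverse, map_sum, map_mul, FreeAlgebra.lift_ι_apply, Sum.elim_inl,
          Sum.elim_inr, Finset.unop_sum, MulOpposite.unop_mul, MulOpposite.unop_op]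
        refine (inv_mul_incl k R (antiMatrix σ hσ A) j i).trans ?_
        by_cases hij : i = j
        · simp [hij]
        · simp [hij, Ne.symm hij]
      | inv_mul A i j =>
        apply MulOpposite.unop_injective
        simp only [base, inverse, map_sum, map_mul, FreeAlgebra.lift_ι_apply, Sum.elim_inl,
          Sum.elim_inr, Finset.unop_sum, MulOpposite.unop_mul, MulOpposite.unop_op]
        refine (incl_mul_inv k R (antiMatrix σ hσ A) j i).trans ?_
        by_cases hij : i = j
        · simp [hij]
        · simp [hij, Ne.symm hij]⟩

theorem antiHom_incl (σ : R →ₐ[k] Rᵐᵒᵖ) (hσ : ∀ a, (σ (σ a).unop).unop = a) (a : R) :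
    antiHom σ hσ (incl k R a) = MulOpposite.op (incl k R (σ a).unop) := by
  change antiHom σ hσ (RingQuot.mkAlgHom k (Rel k R) (base k R a)) = _
  simp [antiHom, base]

theorem antiHom_inv (σ : R →ₐ[k] Rᵐᵒᵖ) (hσ : ∀ a, (σ (σ a).unop).unop = a) {n : ℕ}
    (A : {A : Matrix (Fin n) (Fin n) R // IsFullMatrix A}) (i j : Fin n) :
    antiHom σ hσ (inv k R A i j) = MulOpposite.op (inv k R (antiMatrix σ hσ A) j i) := by
  simp [antiHom, inv, inverse]

theorem antiHom_antiHom (σ : R →ₐ[k] Rᵐᵒᵖ) (hσ : ∀ a, (σ (σ a).unop).unop = a)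
    (r : FullLocalization k R) : (antiHom σ hσ (antiHom σ hσ r).unop).unop = r := by
  let φ : FullLocalization k R →ₐ[k] FullLocalization k R :=
    (AlgEquiv.opOp k (FullLocalization k R)).symm.toAlgHom.comp
      ((AlgHom.op (antiHom σ hσ)).comp (antiHom σ hσ))
  have hφ : φ = AlgHom.id k _ := by
    apply RingQuot.ringQuot_ext'
    apply FreeAlgebra.hom_ext
    funext g
    rcases g with a | ⟨n, A, i, j⟩
    · change (antiHom σ hσ (antiHom σ hσ (incl k R a)).unop).unop = incl k R a
      simp only [antiHom_incl, MulOpposite.unop_op, hσ]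
    · change (antiHom σ hσ (antiHom σ hσ (inv k R A i j)).unop).unop = inv k R A i j
      have hA : antiMatrix σ hσ (antiMatrix σ hσ A) = A := by
        apply Subtype.ext
        funext i j
        exact hσ (A.1 i j)
      simp only [antiHom_inv, MulOpposite.unop_op, hA]
  exact DFunLike.congr_fun hφ r

end Anti

end FullLocalization

/-! ### Noncommutative Laurent polynomials and rational functions in `x, y` -/

/-- The group of Laurent monomials in the noncommuting variables `x, y`. -/
abbrev Monomials : Type := FreeGroup (Fin 2)

namespace Monomials

/-- The variable `x`. -/
def x : Monomials := FreeGroup.of 0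

/-- The variable `y`. -/
def y : Monomials := FreeGroup.of 1

/-- The commutator `C = x y x⁻¹ y⁻¹`. -/
def C : Monomials := x * y * x⁻¹ * y⁻¹

/-- The anti-automorphism `*` on monomials: `x ↦ y C`, `y ↦ C⁻¹ x`. -/
def starHom : Monomials →* Monomialsᵐᵒᵖ :=
  FreeGroup.lift ![MulOpposite.op (y * C), MulOpposite.op (C⁻¹ * x)]

/-- The monomial `g*`. -/
def star (g : Monomials) : Monomials := (starHom g).unop

theorem star_mul (g h : Monomials) : star (g * h) = star h * star g := by
  simp [star]

theorem star_inv (g : Monomials) : star g⁻¹ = (star g)⁻¹ := by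
  simp [star]

theorem star_x : star x = y * C := by
  simp [star, starHom, x]

theorem star_y : star y = C⁻¹ * x := by
  simp [star, starHom, y]

theorem star_star (g : Monomials) : star (star g) = g := by
  have hC : star C = C := by
    simp only [C, star_mul, star_inv, star_x, star_y]
    group
  induction g using FreeGroup.induction_on with
  | C1 => simp [star]
  | of i =>
    fin_cases i
    · change star (star x) = x
      rw [star_x, star_mul, hC, star_y, mul_inv_cancel_left]
    · change star (star y) = y
      rw [star_y, star_mul, star_inv, hC, star_x, mul_inv_cancel_right]
  | inv_of i h => rw [star_inv, star_inv, h]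
  | mul g h hg hh => rw [star_mul, star_mul, hg, hh]

end Monomials

/-- Noncommutative Laurent polynomials in `x, y` with complex coefficients; the coefficient of the
monomial `g` in `P` is `P.coeff g`. -/
abbrev LaurentPolynomials : Type := MonoidAlgebra ℂ Monomials

/-- The anti-automorphism `*` on Laurent polynomials. -/
noncomputable def LaurentPolynomials.star : LaurentPolynomials →ₐ[ℂ] LaurentPolynomialsᵐᵒᵖ :=
  MonoidAlgebra.lift ℂ LaurentPolynomialsᵐᵒᵖ Monomials
    ((MonoidHom.op (MonoidAlgebra.of ℂ Monomials)).comp Monomials.starHom)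

theorem LaurentPolynomials.star_star (P : LaurentPolynomials) :
    (LaurentPolynomials.star (LaurentPolynomials.star P).unop).unop = P := by
  let φ : LaurentPolynomials →ₐ[ℂ] LaurentPolynomials :=
    (AlgEquiv.opOp ℂ LaurentPolynomials).symm.toAlgHom.comp
      ((AlgHom.op LaurentPolynomials.star).comp LaurentPolynomials.star)
  have hφ : φ = AlgHom.id ℂ _ := by
    refine MonoidAlgebra.algHom_ext ?_ (by ext)
    intro g
    have h : ∀ g : Monomials, (LaurentPolynomials.star (MonoidAlgebra.of ℂ Monomials g)).unop
        = MonoidAlgebra.of ℂ Monomials (Monomials.star g) := by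
      intro g
      simp only [LaurentPolynomials.star, MonoidAlgebra.lift_of]
      rfl
    change (LaurentPolynomials.star
      (LaurentPolynomials.star (MonoidAlgebra.of ℂ Monomials g)).unop).unop
        = MonoidAlgebra.of ℂ Monomials g
    rw [h, h, Monomials.star_star]
  exact DFunLike.congr_fun hφ P

/-- The skew field `𝔽 = ℂ(x, y)` of rational functions in the noncommuting variables `x, y`, built
as the universal skew field of fractions of the ring of noncommutative Laurent polynomials. -/
abbrev RationalFunctions : Type := FullLocalization ℂ LaurentPolynomials

namespace RationalFunctions

/-- A Laurent polynomial as a rational function. -/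
noncomputable def ofLaurent : LaurentPolynomials →ₐ[ℂ] RationalFunctions :=
  FullLocalization.incl ℂ LaurentPolynomials

/-- A Laurent monomial as a rational function. -/
noncomputable def ofMonomial : Monomials →* RationalFunctions :=
  (ofLaurent : LaurentPolynomials →* RationalFunctions).comp (MonoidAlgebra.of ℂ Monomials)

/-- The anti-automorphism `*` of `𝔽`, as an isomorphism onto the opposite ring. -/
noncomputable def starEquiv : RationalFunctions ≃ₐ[ℂ] RationalFunctionsᵐᵒᵖ :=
  AlgEquiv.ofBijective
    (FullLocalization.antiHom LaurentPolynomials.star LaurentPolynomials.star_star)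
    (by
      have h := FullLocalization.antiHom_antiHom LaurentPolynomials.star
        LaurentPolynomials.star_star
      constructor
      · intro r s hrs
        rw [← h r, ← h s, hrs]
      · intro r
        refine ⟨(FullLocalization.antiHom LaurentPolynomials.star
          LaurentPolynomials.star_star r.unop).unop, ?_⟩
        exact MulOpposite.unop_injective (h r.unop))

/-- The rational function `r*`. -/
noncomputable def star (r : RationalFunctions) : RationalFunctions := (starEquiv r).unop

/-- On monomials, `*` is the anti-automorphism with `x ↦ y C` and `y ↦ C⁻¹ x`. -/
theorem star_ofMonomial (g : Monomials) : star (ofMonomial g) = ofMonomial g.star := by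
  change (FullLocalization.antiHom LaurentPolynomials.star LaurentPolynomials.star_star
    (FullLocalization.incl ℂ LaurentPolynomials (MonoidAlgebra.of ℂ Monomials g))).unop = _
  rw [FullLocalization.antiHom_incl]
  simp only [LaurentPolynomials.star, MonoidAlgebra.lift_of]
  rfl

/-- A solution of the `(2,2)` system with `C R₀ = x` and `R₁ = y`. -/
structure IsSolution (R : ℤ → RationalFunctions) : Prop where
  initial_zero : ofMonomial Monomials.C * R 0 = ofMonomial Monomials.x
  initial_one : R 1 = ofMonomial Monomials.y
  recursion : ∀ n : ℤ, R (n + 1) * ofMonomial Monomials.C * R (n - 1) = R n ^ 2 + 1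

end RationalFunctions

/-! ### Weighted paths on the segment `[0,3]` -/

/-- Paths on the segment `[0,3]` with steps `i → i ± 1`, from `0` to `0`. -/
abbrev SegmentPath : Type := (SimpleGraph.pathGraph 4).Walk 0 0

namespace SegmentPath

open Monomials

/-- The monomial `y x y⁻¹ = C⁻¹ x`, which is the initial value `R₀`. -/
def r0 : Monomials := y * x * y⁻¹

/-- The weight `yᵢ` of a step `i → i - 1`:
`y₁ = y² x⁻¹ y⁻¹`, `y₂ = x⁻¹ y⁻¹`, `y₃ = x y⁻¹` (the value at `0` plays no role). -/
def descentWeight : Fin 4 → Monomials :=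
  ![1, y ^ 2 * x⁻¹ * y⁻¹, x⁻¹ * y⁻¹, x * y⁻¹]

/-- The weight of a step `i → j`: ascending steps have weight `1`. -/
def stepWeight (i j : Fin 4) : Monomials := if i < j then 1 else descentWeight i

/-- The weight of a walk: the product of the step weights, from left to right in the order in which
the steps are taken. -/
def weight : {i j : Fin 4} → (SimpleGraph.pathGraph 4).Walk i j → Monomials
  | _, _, .nil => 1
  | _, _, .cons (u := i) (v := j) _ p => stepWeight i j * weight p

/-- The index `N ≥ 0` such that `R_n` is described by paths with `2 N` steps: `N = n` for `n ≥ 0`,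
and `N = 1 - n` for `n < 0`, where `R_n = (R_{1-n})*`. -/
def halfLength (n : ℤ) : ℕ := if 0 ≤ n then n.toNat else (1 - n).toNat

/-- The monomial contributed to `R_n` by a path `p` of weight `w`: it is `w R₀` for `n ≥ 0`, and
`(w R₀)*` for `n < 0`. -/
def contribution (n : ℤ) (p : SegmentPath) : Monomials :=
  if 0 ≤ n then weight p * r0 else (weight p * r0).star

end SegmentPath

/-! Write `K` for `y₁ + y₂ + y₃` and `P n` for the weighted count of closed paths with `2n` steps,
times `R₀`. Two facts carry the theorem.

Algebra: because the segment stops at height 3 and `y₃y₁ = C`, the path sums satisfy the left linear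
recursion `P (n+2) = K P (n+1) - C P n` (`walkSum_add_four`). They also satisfy the mirror recursion
`P (n+2) = P (n+1) K C⁻¹ - P n C⁻¹`. Together these make `P (n+2) C P n - P (n+1)²` independent of
`n` (`quadratic_recursion`), and its value at `n = 0` is `1`. So `P` solves the system for `n ≥ 0`,
and `*`, which reverses products and fixes `C`, gives the remaining `n`. Nonzero Laurent polynomials
are units in `𝔽`, so the recursion can be solved uniquely in both directions (`IsSolution.eq`).

Freeness: `y₁, y₂, y₃` freely generate a subgroup, so the weight of a path determines the sequence
of its descents, and that sequence determines the path (`weight_injective`). Hence no two paths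
contribute the same monomial and all coefficients are 0 or 1. -/

/-! ### The weights of paths -/

namespace SegmentPath

open SimpleGraph Monomials

variable {i j : Fin 4}

/-- The list of the starting points of the descending steps of a walk. -/
def descents : {i j : Fin 4} → (pathGraph 4).Walk i j → List (Fin 4)
  | _, _, .nil => []
  | _, _, .cons (u := i) (v := j) _ p => if i < j then descents p else i :: descents p

theorem le_of_descents_eq_cons (p : (pathGraph 4).Walk i j) {k : Fin 4} {l : List (Fin 4)}
    (h : descents p = k :: l) : i ≤ k := by
  induction p with
  | nil => simp [descents] at h
  | cons hadj p ih =>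
    rw [descents] at h
    split_ifs at h with hlt
    · exact hlt.le.trans (ih h)
    · exact (List.cons.inj h).1.le

theorem le_of_descents_eq_nil (p : (pathGraph 4).Walk i j) (h : descents p = []) : i ≤ j := by
  induction p with
  | nil => rfl
  | cons hadj p ih =>
    rw [descents] at h
    split_ifs at h with hlt
    exact hlt.le.trans (ih h)

/-- Between consecutive descents a walk only climbs, so the next descent's starting height fixes the
length of the climb; the endpoint fixes any final climb. -/
theorem descents_injective (i : Fin 4) :
    Function.Injective (descents : (pathGraph 4).Walk i 0 → List (Fin 4)) := by
  intro p q h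
  generalize hz : (0 : Fin 4) = z at p q
  induction p with
  | nil =>
    cases q with
    | nil => rfl
    | cons hadj q =>
      subst hz
      rw [descents, descents] at h
      split_ifs at h with hlt
      have := le_of_descents_eq_nil q h.symm
      omega
  | @cons _ v _ hadj p ih =>
    subst hz
    cases q with
    | nil =>
      rw [descents, descents] at h
      split_ifs at h with hlt
      have := le_of_descents_eq_nil p h
      omega
    | @cons _ v' _ hadj' q =>
      rw [pathGraph_adj] at hadj hadj'
      rw [descents, descents] at h
      split_ifs at h with hlt hlt' hlt'
      · obtain rfl : v = v' := by omega
        rw [ih rfl h]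
      · have := le_of_descents_eq_cons p h
        omega
      · have := le_of_descents_eq_cons q h.symm
        omega
      · obtain rfl : v = v' := by omega
        rw [ih rfl (List.cons.inj h).2]

/-! ### Freeness of the descent weights -/

/-- The permutation of `G × Bool` exchanging the two copies of `G` and left multiplying by `a` on
the first one and by `b` on the second one. -/
def swapPerm {G : Type*} [Group G] (a b : G) : Equiv.Perm (G × Bool) where
  toFun z := (cond z.2 b a * z.1, !z.2)
  invFun z := ((cond z.2 a b)⁻¹ * z.1, !z.2)
  left_inv := by rintro ⟨g, _ | _⟩ <;> simp
  right_inv := by rintro ⟨g, _ | _⟩ <;> simp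

/-- The action of the Laurent monomials induced by the index two subgroup freely generated by the
weights of the three descending steps. -/
def inducedAction : Monomials →* Equiv.Perm (FreeGroup (Fin 4) × Bool) :=
  FreeGroup.lift
    ![swapPerm (.of 2 * (.of 1)⁻¹ * (.of 2)⁻¹) (.of 3 * .of 1 * (.of 2)⁻¹),
      swapPerm 1 (.of 1 * (.of 2)⁻¹)]

/-- With `H = ⟨y₁, y₂, y₃⟩`, the pair `(h, false)` stands for `h` and `(h, true)` for `y h`. The
constants in `inducedAction` are then `y⁻¹x = y₂y₁⁻¹y₂⁻¹`, `xy = y₃y₁y₂⁻¹` and `y² = y₁y₂⁻¹`.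
Generator 0 only keeps the indexing by vertices. -/
theorem inducedAction_descentWeight (hi : i ≠ 0) (h : FreeGroup (Fin 4)) :
    inducedAction (descentWeight i) (h, false) = (.of i * h, false) := by
  have hx : inducedAction x = swapPerm (.of 2 * (.of 1)⁻¹ * (.of 2)⁻¹)
      (.of 3 * .of 1 * (.of 2)⁻¹) := by
    simp [inducedAction, x]
  have hy : inducedAction y = swapPerm 1 (.of 1 * (.of 2)⁻¹) := by
    simp [inducedAction, y]
  fin_cases i
  · exact absurd rfl hi
  all_goals
    simp [descentWeight, hx, hy, swapPerm, pow_two, Equiv.Perm.mul_apply,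
      Equiv.symm, mul_assoc]

theorem inducedAction_weight (p : (pathGraph 4).Walk i j) (h : FreeGroup (Fin 4)) :
    inducedAction (weight p) (h, false)
      = (FreeGroup.mk ((descents p).map fun k => (k, true)) * h, false) := by
  induction p with
  | nil => simp [weight, descents, ← FreeGroup.one_eq_mk]
  | cons hadj p ih =>
    rw [weight, descents, map_mul, Equiv.Perm.mul_apply, ih, stepWeight]
    split_ifs with hlt
    · simp
    · rw [inducedAction_descentWeight, List.map_cons, ← List.singleton_append, ← FreeGroup.mul_mk,
        mul_assoc]
      · rfl
      · rw [pathGraph_adj] at hadj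
        omega

theorem weight_injective (i : Fin 4) :
    Function.Injective (weight : (pathGraph 4).Walk i 0 → Monomials) := by
  intro p q h
  apply descents_injective
  -- A positive word has no cancellation, so it can be read off from its class in the free group.
  have hred : ∀ l : List (Fin 4), (FreeGroup.mk (l.map fun k => (k, true))).toWord
      = l.map fun k => (k, true) := by
    intro l
    rw [FreeGroup.toWord_mk]
    apply FreeGroup.IsReduced.reduce_eq
    rw [FreeGroup.IsReduced, List.isChain_map]
    simp [List.isChain_iff_getElem]
  have h1 := inducedAction_weight p 1
  rw [h, inducedAction_weight, mul_one, mul_one, Prod.mk.injEq] at h1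
  have h2 := congrArg FreeGroup.toWord h1.1
  rw [hred, hred] at h2
  exact (List.map_injective_iff.2 (fun a b hab => (Prod.mk.inj hab).1) h2).symm

theorem contribution_injective (n : ℤ) : Function.Injective (contribution n) := by
  intro p q h
  apply weight_injective
  unfold contribution at h
  split_ifs at h
  · exact mul_right_cancel h
  · exact mul_right_cancel (Function.LeftInverse.injective star_star h)

theorem exists_length_eq (n : ℕ) : ∃ p : SegmentPath, p.length = 2 * n := by
  induction n with
  | zero => exact ⟨.nil, rfl⟩
  | succ n ih =>
    obtain ⟨p, hp⟩ := ih
    have h : (pathGraph 4).Adj 0 1 := by simp [pathGraph_adj]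
    exact ⟨.cons h (.cons h.symm p), by simp [hp]; ring⟩

/-! ### The generating functions of paths -/

/-- The sum of the weights of the walks from `i` to `0` with `k` steps. -/
noncomputable def walkSum (k : ℕ) (i : Fin 4) : LaurentPolynomials :=
  open scoped Classical in
  ∑ p ∈ (pathGraph 4).finsetWalkLength k i 0, MonoidAlgebra.of ℂ Monomials (weight p)

theorem walkSum_succ (k : ℕ) (i : Fin 4) :
    walkSum (k + 1) i = ∑ j ∈ Finset.univ.filter fun j : Fin 4 =>
      i.val + 1 = j.val ∨ j.val + 1 = i.val,
      MonoidAlgebra.of ℂ Monomials (stepWeight i j) * walkSum k j := by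
  classical
  rw [walkSum, finsetWalkLength, Finset.sum_biUnion]
  · simp_rw [Finset.sum_map]
    trans ∑ j : (pathGraph 4).neighborSet i, MonoidAlgebra.of ℂ Monomials (stepWeight i j) *
      walkSum k j
    · refine Finset.sum_congr rfl fun j _ => ?_
      rw [walkSum, Finset.mul_sum]
      refine Finset.sum_congr (by congr!) fun p _ => ?_
      exact map_mul _ _ _
    · refine (Finset.sum_subtype (p := fun j => j ∈ (pathGraph 4).neighborSet i) _ ?_
        fun j => MonoidAlgebra.of ℂ Monomials (stepWeight i j) * walkSum k j).symm
      simp [pathGraph_adj]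
  · intro a _ b _ hab
    rw [Function.onFun, Finset.disjoint_left]
    intro p hp hq
    obtain ⟨p, _, rfl⟩ := Finset.mem_map.1 hp
    obtain ⟨q, _, hq⟩ := Finset.mem_map.1 hq
    exact hab (Subtype.ext (Walk.cons.inj hq).1.symm)

theorem walkSum_zero_zero : walkSum 0 0 = 1 := by
  simp [walkSum, finsetWalkLength, weight, MonoidAlgebra.one_def]

theorem walkSum_two_zero : walkSum 0 2 = 0 := by
  simp [walkSum, finsetWalkLength]

theorem walkSum_succ_zero (k : ℕ) : walkSum (k + 1) 0 = walkSum k 1 := by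
  rw [walkSum_succ, show (Finset.univ.filter fun j : Fin 4 =>
    (0 : Fin 4).val + 1 = j.val ∨ j.val + 1 = (0 : Fin 4).val) = {1} by decide,
    Finset.sum_singleton, stepWeight, if_pos (by decide), map_one, one_mul]

theorem walkSum_succ_one (k : ℕ) : walkSum (k + 1) 1 =
    MonoidAlgebra.of ℂ Monomials (descentWeight 1) * walkSum k 0 + walkSum k 2 := by
  rw [walkSum_succ, show (Finset.univ.filter fun j : Fin 4 =>
    (1 : Fin 4).val + 1 = j.val ∨ j.val + 1 = (1 : Fin 4).val) = {0, 2} by decide,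
    Finset.sum_pair (by decide), stepWeight, stepWeight, if_neg (by decide), if_pos (by decide),
    map_one, one_mul]

theorem walkSum_succ_two (k : ℕ) : walkSum (k + 1) 2 =
    MonoidAlgebra.of ℂ Monomials (descentWeight 2) * walkSum k 1 + walkSum k 3 := by
  rw [walkSum_succ, show (Finset.univ.filter fun j : Fin 4 =>
    (2 : Fin 4).val + 1 = j.val ∨ j.val + 1 = (2 : Fin 4).val) = {1, 3} by decide,
    Finset.sum_pair (by decide), stepWeight, stepWeight, if_neg (by decide), if_pos (by decide),
    map_one, one_mul]

theorem walkSum_succ_three (k : ℕ) : walkSum (k + 1) 3 =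
    MonoidAlgebra.of ℂ Monomials (descentWeight 3) * walkSum k 2 := by
  rw [walkSum_succ, show (Finset.univ.filter fun j : Fin 4 =>
    (3 : Fin 4).val + 1 = j.val ∨ j.val + 1 = (3 : Fin 4).val) = {2} by decide,
    Finset.sum_singleton, stepWeight, if_neg (by decide)]

/-- The conserved quantity `y₁ + y₂ + y₃`. -/
noncomputable def weightSum : LaurentPolynomials :=
  MonoidAlgebra.of ℂ Monomials (descentWeight 1) + MonoidAlgebra.of ℂ Monomials (descentWeight 2)
    + MonoidAlgebra.of ℂ Monomials (descentWeight 3)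

/-- Eliminate the walk sums from vertices 1, 2 and 3. The elimination closes because vertex 3 leads
only back to 2. -/
theorem walkSum_add_four (k : ℕ) : walkSum (k + 4) 0 =
    weightSum * walkSum (k + 2) 0 - MonoidAlgebra.of ℂ Monomials C * walkSum k 0 := by
  have hC : descentWeight 3 * descentWeight 1 = C := by decide
  have h : walkSum k 2 = walkSum (k + 2) 0 -
      MonoidAlgebra.of ℂ Monomials (descentWeight 1) * walkSum k 0 := by
    rw [walkSum_succ_zero, walkSum_succ_one, add_sub_cancel_left]
  rw [walkSum_succ_zero, walkSum_succ_one, walkSum_succ_two, ← walkSum_succ_zero,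
    walkSum_succ_three, h, weightSum, ← hC, map_mul]
  noncomm_ring

/-- The generating function of the closed walks at `0` with `2 n` steps, times `R₀`. -/
noncomputable def closedWalkSum (n : ℕ) : LaurentPolynomials :=
  walkSum (2 * n) 0 * MonoidAlgebra.of ℂ Monomials r0

theorem closedWalkSum_add_two (n : ℕ) : closedWalkSum (n + 2) =
    weightSum * closedWalkSum (n + 1) - MonoidAlgebra.of ℂ Monomials C * closedWalkSum n := by
  rw [closedWalkSum, show 2 * (n + 2) = 2 * n + 4 by ring, walkSum_add_four, sub_mul, mul_assoc,
    mul_assoc]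
  rfl

theorem closedWalkSum_zero : closedWalkSum 0 = MonoidAlgebra.of ℂ Monomials r0 := by
  rw [closedWalkSum, mul_zero, walkSum_zero_zero, one_mul]

theorem closedWalkSum_one : closedWalkSum 1 = MonoidAlgebra.of ℂ Monomials y := by
  rw [closedWalkSum, mul_one, walkSum_succ_zero 1, walkSum_succ_one 0, walkSum_zero_zero,
    walkSum_two_zero, mul_one, add_zero, ← map_mul]
  exact congrArg _ (by decide)

/-! ### From linear recursions to the quadratic one -/

/-- A sequence satisfying a left linear recursion and a compatible right linear recursion satisfies
a quadratic recursion. -/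
theorem quadratic_recursion {A : Type*} [Ring A] {c c' K b : A} (hc : c' * c = 1) {P : ℕ → A}
    (hP : ∀ n, P (n + 2) = K * P (n + 1) - c * P n)
    (h0 : P 2 = P 1 * K * c' - P 0 * c') (h1 : P 3 = P 2 * K * c' - P 1 * c')
    (hb : P 2 * c * P 0 = P 1 ^ 2 + b) (n : ℕ) :
    P (n + 2) * c * P n = P (n + 1) ^ 2 + b := by
  -- Left and right multiplications commute, so the right recursion propagates from its first two
  -- instances.
  have hright : ∀ n, P (n + 2) = P (n + 1) * K * c' - P n * c' ∧
      P (n + 3) = P (n + 2) * K * c' - P (n + 1) * c' := by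
    intro n
    induction n with
    | zero => exact ⟨h0, h1⟩
    | succ n ih =>
      refine ⟨ih.2, ?_⟩
      calc P (n + 4) = K * P (n + 3) - c * P (n + 2) := hP (n + 2)
        _ = K * (P (n + 2) * K * c' - P (n + 1) * c') - c * (P (n + 1) * K * c' - P n * c') := by
          rw [ih.2, ← ih.1]
        _ = (K * P (n + 2) - c * P (n + 1)) * K * c' - (K * P (n + 1) - c * P n) * c' := by
          noncomm_ring
        _ = P (n + 3) * K * c' - P (n + 2) * c' := by rw [← hP n, ← hP (n + 1)]
  induction n with
  | zero => exact hb
  | succ n ih =>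
    -- The left recursion rewrites the old product and the right one the new; both contain `P (n+2)
    -- K P (n+1)`, which is eliminated.
    have h2 : c * P n = K * P (n + 1) - P (n + 2) := by rw [hP n]; abel
    have h3 : P (n + 3) * c = P (n + 2) * K - P (n + 1) := by
      rw [(hright n).2, sub_mul, mul_assoc _ c', mul_assoc _ c', hc, mul_one, mul_one]
    rw [mul_assoc, h2, mul_sub, ← pow_two, sub_eq_iff_eq_add] at ih
    rw [h3, sub_mul, mul_assoc, ih]
    noncomm_ring

theorem weightSum_mul_y : weightSum * MonoidAlgebra.of ℂ Monomials y
      - MonoidAlgebra.of ℂ Monomials C * MonoidAlgebra.of ℂ Monomials r0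
    = MonoidAlgebra.of ℂ Monomials y * weightSum * MonoidAlgebra.of ℂ Monomials C⁻¹
      - MonoidAlgebra.of ℂ Monomials r0 * MonoidAlgebra.of ℂ Monomials C⁻¹ := by
  have h1 : descentWeight 1 * y = y * descentWeight 1 * C⁻¹ := by decide
  have h2 : descentWeight 2 * y = y * descentWeight 2 * C⁻¹ := by decide
  have h3 : descentWeight 3 * y = C * r0 := by decide
  have h4 : y * descentWeight 3 = r0 := by decide
  simp only [weightSum, mul_add, add_mul, ← map_mul, h1, h2, h3, h4]
  abel

/-- What remains of the second instance of the right recursion once `K y K C⁻¹` cancels. -/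
theorem weightSum_mul_r0 : weightSum * MonoidAlgebra.of ℂ Monomials r0
        * MonoidAlgebra.of ℂ Monomials C⁻¹
      + MonoidAlgebra.of ℂ Monomials C * MonoidAlgebra.of ℂ Monomials y
    = MonoidAlgebra.of ℂ Monomials C * MonoidAlgebra.of ℂ Monomials r0 * weightSum
        * MonoidAlgebra.of ℂ Monomials C⁻¹
      + MonoidAlgebra.of ℂ Monomials y * MonoidAlgebra.of ℂ Monomials C⁻¹ := by
  have h1 : descentWeight 1 * r0 = y := by decide
  have h2 : descentWeight 2 * r0 = C * r0 * descentWeight 2 := by decide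
  have h3 : descentWeight 3 * r0 = C * r0 * descentWeight 3 := by decide
  have h4 : C * y = C * r0 * descentWeight 1 * C⁻¹ := by decide
  simp only [weightSum, mul_add, add_mul, ← map_mul, h1, h2, h3, h4]
  abel

theorem weightSum_mul_y_mul_C_mul_r0 : (weightSum * MonoidAlgebra.of ℂ Monomials y
      - MonoidAlgebra.of ℂ Monomials C * MonoidAlgebra.of ℂ Monomials r0)
      * MonoidAlgebra.of ℂ Monomials C * MonoidAlgebra.of ℂ Monomials r0
    = MonoidAlgebra.of ℂ Monomials y ^ 2 + 1 := by
  have h1 : descentWeight 1 * y * C * r0 = y ^ 2 := by decide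
  have h2 : descentWeight 2 * y * C * r0 = 1 := by decide
  have h3 : descentWeight 3 * y = C * r0 := by decide
  simp only [weightSum, sub_mul, add_mul, ← map_mul, h1, h2, h3, map_pow, map_one]
  abel

theorem closedWalkSum_recursion (n : ℕ) :
    closedWalkSum (n + 2) * MonoidAlgebra.of ℂ Monomials C * closedWalkSum n
      = closedWalkSum (n + 1) ^ 2 + 1 := by
  have h2 := closedWalkSum_add_two 0
  have h3 := closedWalkSum_add_two 1
  have hr := weightSum_mul_r0
  simp only [zero_add, Nat.reduceAdd, closedWalkSum_zero, closedWalkSum_one] at h2 h3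
  refine quadratic_recursion (c' := MonoidAlgebra.of ℂ Monomials C⁻¹) (K := weightSum) ?_
    closedWalkSum_add_two ?_ ?_ ?_ n
  · rw [← map_mul, inv_mul_cancel, map_one]
  · rw [h2, closedWalkSum_zero, closedWalkSum_one, weightSum_mul_y]
  · rw [h3, closedWalkSum_one, sub_eq_sub_iff_add_eq_add]
    -- The right form of `P 2` on this side and the left form on the other make `K y K C⁻¹` appear
    -- on both.
    conv_lhs => rw [h2, weightSum_mul_y]
    rw [h2, mul_sub, sub_mul, sub_mul, sub_add_eq_add_sub, sub_add_eq_add_sub,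
      sub_eq_sub_iff_add_eq_add]
    simp only [← mul_assoc] at hr ⊢
    rw [add_assoc, add_assoc, ← add_comm (_ * _ * _ : LaurentPolynomials), ← hr]
    abel
  · rw [h2, closedWalkSum_zero, closedWalkSum_one, weightSum_mul_y_mul_C_mul_r0]

theorem coeff_closedWalkSum (n : ℕ) (g : Monomials) :
    (closedWalkSum n).coeff g =
      open scoped Classical in
      if ∃ p : SegmentPath, p.length = 2 * n ∧ weight p * r0 = g then 1 else 0 := by
  classical
  rw [closedWalkSum, walkSum, Finset.sum_mul]
  simp only [← map_mul]
  rw [MonoidAlgebra.coeff_sum, Finsupp.finsetSum_apply]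
  simp only [MonoidAlgebra.of_apply, MonoidAlgebra.coeff_single, Finsupp.single_apply]
  split_ifs with h
  · obtain ⟨p, hp, rfl⟩ := h
    rw [Finset.sum_eq_single p, if_pos rfl]
    · intro q _ hq
      exact if_neg fun h => hq (weight_injective 0 (mul_right_cancel h))
    · intro h
      exact absurd (mem_finsetWalkLength_iff.2 hp) h
  · refine Finset.sum_eq_zero fun p hp => if_neg fun hg => h ⟨p, mem_finsetWalkLength_iff.1 hp, hg⟩

end SegmentPath

/-! ### The anti-automorphism on coefficients -/

namespace LaurentPolynomials

theorem star_of (g : Monomials) : (star (MonoidAlgebra.of ℂ Monomials g)).unop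
    = MonoidAlgebra.of ℂ Monomials g.star := by
  simp only [star, MonoidAlgebra.lift_of]
  rfl

theorem coeff_star (P : LaurentPolynomials) (g : Monomials) :
    (star P).unop.coeff g = P.coeff g.star := by
  classical
  induction P using MonoidAlgebra.induction_linear with
  | zero => simp
  | add P Q hP hQ => simp [hP, hQ]
  | single h c =>
    have : MonoidAlgebra.single h c = c • MonoidAlgebra.of ℂ Monomials h := by simp
    rw [this, map_smul, MulOpposite.unop_smul, star_of]
    simp only [MonoidAlgebra.coeff_smul_apply, MonoidAlgebra.of_apply, MonoidAlgebra.coeff_single,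
      Finsupp.single_apply]
    congr 2
    exact propext ⟨fun h => by rw [← h, Monomials.star_star],
      fun h => by rw [h, Monomials.star_star]⟩

end LaurentPolynomials

/-! ### Existence, uniqueness and symmetry of the solution -/

namespace RationalFunctions

open Monomials SegmentPath

/-- A nonzero `1 × 1` matrix is full: factoring through size 0 would make it zero. -/
theorem isUnit_ofLaurent {P : LaurentPolynomials} (hP : P ≠ 0) : IsUnit (ofLaurent P) := by
  have hfull : IsFullMatrix (fun _ _ => P : Matrix (Fin 1) (Fin 1) LaurentPolynomials) := by
    intro m A B h
    by_contra hm
    obtain rfl : m = 0 := by omega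
    have h0 := congrFun (congrFun h 0) 0
    rw [Matrix.mul_apply, Fin.sum_univ_zero] at h0
    exact hP h0
  have h1 := FullLocalization.incl_mul_inv ℂ LaurentPolynomials ⟨_, hfull⟩ 0 0
  have h2 := FullLocalization.inv_mul_incl ℂ LaurentPolynomials ⟨_, hfull⟩ 0 0
  rw [Fin.sum_univ_one, if_pos rfl] at h1 h2
  exact ⟨⟨_, _, h1, h2⟩, rfl⟩

theorem star_mul (r s : RationalFunctions) : star (r * s) = star s * star r := by
  simp [star]

theorem star_add (r s : RationalFunctions) : star (r + s) = star r + star s := by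
  simp [star]

theorem star_one : star 1 = 1 := by
  simp [star]

theorem star_ofLaurent (P : LaurentPolynomials) :
    star (ofLaurent P) = ofLaurent (LaurentPolynomials.star P).unop := by
  change (FullLocalization.antiHom LaurentPolynomials.star LaurentPolynomials.star_star
    (FullLocalization.incl ℂ LaurentPolynomials P)).unop = _
  rw [FullLocalization.antiHom_incl]
  rfl

/-- Units are needed only for `S`: wherever the two sequences agree, the factor to cancel is a value
of `S`. -/
theorem IsSolution.eq {R S : ℤ → RationalFunctions} (hR : IsSolution R) (hS : IsSolution S)
    (hu : ∀ n, IsUnit (S n)) : R = S := by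
  have hC : IsUnit (ofMonomial C) := (Group.isUnit C).map ofMonomial
  have h : ∀ n : ℤ, R n = S n ∧ R (n + 1) = S (n + 1) := by
    intro n
    induction n using Int.induction_on with
    | zero =>
      exact ⟨hC.mul_left_cancel (hR.initial_zero.trans hS.initial_zero.symm),
        hR.initial_one.trans hS.initial_one.symm⟩
    | succ n ih =>
      refine ⟨ih.2, ?_⟩
      have h1 := hR.recursion (n + 1)
      rw [ih.2, ← hS.recursion, add_sub_cancel_right, ih.1] at h1
      exact hC.mul_right_cancel ((hu n).mul_right_cancel h1)
    | pred n ih =>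
      rw [sub_add_cancel]
      refine ⟨?_, ih.1⟩
      have h1 := hR.recursion (-n)
      rw [ih.1, ← hS.recursion, ih.2] at h1
      exact ((hu _).mul hC).mul_left_cancel h1
  exact funext fun n => (h n).1

theorem IsSolution.star {R : ℤ → RationalFunctions} (hR : IsSolution R) :
    IsSolution fun n => RationalFunctions.star (R (1 - n)) where
  initial_zero := by
    rw [sub_zero, hR.initial_one, star_ofMonomial, star_y, ← map_mul, mul_inv_cancel_left]
  initial_one := by
    have h : R 0 = ofMonomial (C⁻¹ * x) := by
      rw [map_mul, ← hR.initial_zero, ← mul_assoc, ← map_mul, inv_mul_cancel, map_one, one_mul]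
    rw [sub_self, h, star_ofMonomial]
    exact congrArg _ (by decide)
  recursion n := by
    have hC : RationalFunctions.star (ofMonomial C) = ofMonomial C := by
      rw [star_ofMonomial]
      exact congrArg _ (by decide)
    have h := congrArg RationalFunctions.star (hR.recursion (1 - n))
    rw [star_mul, star_mul, star_add, star_one, pow_two, star_mul, ← pow_two, hC, ← mul_assoc] at h
    convert h using 5 <;> ring

/-- The Laurent polynomial representing the solution at `n`. -/
noncomputable def solution (n : ℤ) : LaurentPolynomials :=
  if 0 ≤ n then closedWalkSum (halfLength n)
  else (LaurentPolynomials.star (closedWalkSum (halfLength n))).unop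

theorem coeff_solution (n : ℤ) (g : Monomials) :
    (solution n).coeff g =
      open scoped Classical in
      if ∃ p : SegmentPath, p.length = 2 * halfLength n ∧ contribution n p = g
        then 1 else 0 := by
  classical
  unfold solution contribution
  by_cases hn : 0 ≤ n
  · simp only [if_pos hn]
    exact coeff_closedWalkSum _ g
  · simp only [if_neg hn]
    rw [LaurentPolynomials.coeff_star, coeff_closedWalkSum]
    congr! 4
    exact ⟨fun h => by rw [h, Monomials.star_star], fun h => by rw [← h, Monomials.star_star]⟩

theorem solution_ne_zero (n : ℤ) : solution n ≠ 0 := by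
  classical
  intro h
  obtain ⟨p, hp⟩ := exists_length_eq (halfLength n)
  have h1 := coeff_solution n (contribution n p)
  rw [if_pos ⟨p, hp, rfl⟩, h] at h1
  simp at h1

theorem bijOn_contribution (n : ℤ) : Set.BijOn (contribution n)
    {p : SegmentPath | p.length = 2 * halfLength n} {g : Monomials | (solution n).coeff g ≠ 0} := by
  classical
  refine ⟨fun p hp => ?_, (contribution_injective n).injOn, fun g hg => ?_⟩
  · rw [Set.mem_ofPred_eq, coeff_solution, if_pos ⟨p, hp, rfl⟩]
    exact one_ne_zero
  · rw [Set.mem_ofPred_eq, coeff_solution] at hg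
    exact (ite_ne_right_iff.1 hg).1

theorem solution_natCast (n : ℕ) : solution n = closedWalkSum n := by
  simp [solution, halfLength]

/-- The two halves of `solution` overlap consistently at 0 and 1 because `*` exchanges `R₀` and `y`.
-/
theorem solution_one_sub_natCast (n : ℕ) :
    solution (1 - n) = (LaurentPolynomials.star (closedWalkSum n)).unop := by
  rcases n with _ | _ | n
  · rw [Nat.cast_zero, sub_zero, ← Nat.cast_one, solution_natCast, closedWalkSum_zero,
      closedWalkSum_one, LaurentPolynomials.star_of]
    exact congrArg _ (by decide)
  · rw [zero_add, Nat.cast_one, sub_self, ← Nat.cast_zero, solution_natCast, closedWalkSum_zero,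
      closedWalkSum_one, LaurentPolynomials.star_of]
    exact congrArg _ (by decide)
  · have h : halfLength (1 - (n + 1 + 1 : ℕ)) = n + 1 + 1 := by
      rw [halfLength, if_neg (by omega)]
      omega
    rw [solution, if_neg (by omega), h]

theorem isSolution_solution : IsSolution fun n => ofLaurent (solution n) where
  initial_zero := by
    change _ * ofLaurent (solution (0 : ℕ)) = _
    rw [solution_natCast, closedWalkSum_zero]
    change _ * ofMonomial r0 = _
    rw [← map_mul]
    exact congrArg _ (by decide)
  initial_one := by
    change ofLaurent (solution (1 : ℕ)) = _
    rw [solution_natCast, closedWalkSum_one]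
    rfl
  recursion n := by
    have key : ∀ n : ℕ, ofLaurent (closedWalkSum (n + 2)) * ofMonomial C
        * ofLaurent (closedWalkSum n) = ofLaurent (closedWalkSum (n + 1)) ^ 2 + 1 := by
      intro n
      have h := congrArg ofLaurent (closedWalkSum_recursion n)
      rwa [map_mul, map_mul, map_add, map_pow, map_one] at h
    have hC : RationalFunctions.star (ofMonomial C) = ofMonomial C := by
      rw [star_ofMonomial]
      exact congrArg _ (by decide)
    obtain ⟨n, rfl⟩ | ⟨n, rfl⟩ : (∃ m : ℕ, n = m + 1) ∨ ∃ m : ℕ, n = -m := by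
      rcases lt_or_ge 0 n with h | h
      · exact .inl ⟨(n - 1).toNat, by omega⟩
      · exact .inr ⟨(-n).toNat, by omega⟩
    · rw [add_sub_cancel_right]
      exact_mod_cast (by simpa only [← solution_natCast] using key n)
    · have h := congrArg RationalFunctions.star (key n)
      rw [star_mul, star_mul, star_add, star_one, pow_two, star_mul, ← pow_two, hC, star_ofLaurent,
        star_ofLaurent, star_ofLaurent, ← solution_one_sub_natCast, ← solution_one_sub_natCast,
        ← solution_one_sub_natCast, ← mul_assoc] at h
      rwa [show (1 : ℤ) - n = -n + 1 by omega, show (1 : ℤ) - (n + 2 : ℕ) = -n - 1 by omega,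
        show (1 : ℤ) - (n + 1 : ℕ) = -n by omega] at h

end RationalFunctions

theorem mainTheorem2 :
    (∃! R : ℤ → RationalFunctions, RationalFunctions.IsSolution R) ∧
    ∀ R : ℤ → RationalFunctions, RationalFunctions.IsSolution R →
      (∀ n : ℤ, R (-n) = RationalFunctions.star (R (n + 1))) ∧
      ∀ n : ℤ, ∃ P : LaurentPolynomials,
        R n = RationalFunctions.ofLaurent P ∧
        (∀ g : Monomials, P.coeff g = 0 ∨ P.coeff g = 1) ∧
        Set.BijOn (SegmentPath.contribution n)
          {p : SegmentPath | p.length = 2 * SegmentPath.halfLength n}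
          {g : Monomials | P.coeff g ≠ 0} := by
  classical
  have huniq : ∀ R, RationalFunctions.IsSolution R →
      R = fun n => RationalFunctions.ofLaurent (RationalFunctions.solution n) := fun R hR =>
    hR.eq RationalFunctions.isSolution_solution fun n =>
      RationalFunctions.isUnit_ofLaurent (RationalFunctions.solution_ne_zero n)
  refine ⟨⟨_, RationalFunctions.isSolution_solution, huniq⟩, fun R hR => ⟨fun n => ?_, fun n =>
    ⟨RationalFunctions.solution n, congrFun (huniq R hR) n, fun g => ?_,
      RationalFunctions.bijOn_contribution n⟩⟩⟩
  · have h := congrFun ((huniq R hR).trans (huniq _ hR.star).symm) (-n)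
    rwa [sub_neg_eq_add, add_comm 1 n] at h
  · rw [RationalFunctions.coeff_solution]
    split_ifs <;> simp
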